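/- For an $n\times n$ complex matrix $A$ let $W(A)=\{\langle Ax,x\rangle : x\in\mathbb C^n,\ \|x\|=1\}$ be its numerical range. Call a set $W\subset\mathbb C$ bi-elliptical if it is the convex hull $\operatorname{conv}(E_1\cup E_2)$ of two (non-degenerate) ellipses $E_1,E_2$ with distinct centers, neither of which is contained in the convex hull of the other. Let $\alpha=iv$ with $v\in\mathbb R$, $v\neq 0$, let $b_1,b_2\in\mathbb C$ and $b\in\mathbb R$, $b\ge 0$, put $\eta_j=\operatorname{Im} b_j$ for $j=1,2$, and let \[ A=\begin{bmatrix} \alpha & 0 & \overline{b_1}+1 & 0 \\ 0 & \alpha & b & \overline{b_2}+1 \\ b_1-1 & b & -\alpha & 0 \\ 0 & b_2-1 & 0 & -\alpha \end{bmatrix}. \] Then $W(A)$ is bi-elliptical if and only if $b\neq 0$, $|b_1|=|b_2|$, and $v^2b^2=(\eta_1-\eta_2)^2$. -/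

import Mathlib

/-- The numerical range of a square complex matrix: all values `⟨A x, x⟩ = x^* A x` over the
unit vectors `x` for the Euclidean norm. (Mathlib's inner product is conjugate-linear in its
first argument.) -/
def numericalRange {n : Type*} [Fintype n] (A : Matrix n n ℂ) : Set ℂ :=
  {w | ∃ x : EuclideanSpace ℂ n, ‖x‖ = 1 ∧ inner ℂ x (WithLp.toLp 2 (A.mulVec x)) = w}

/-- `E` is a (non-degenerate) ellipse in the complex plane with center `c`: for some rotation
angle `φ` and some semi-axes `r, s > 0` it is the curve `c + e^{iφ} (r cos t + i s sin t)`. -/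
def IsEllipse (E : Set ℂ) (c : ℂ) : Prop :=
  ∃ φ r s : ℝ, 0 < r ∧ 0 < s ∧
    E = Set.range fun t : ℝ => c + Complex.exp (φ * Complex.I) * ⟨r * Real.cos t, s * Real.sin t⟩

/-- A plane set is bi-elliptical if it is the convex hull of two ellipses with distinct centers.
Both ellipses have to matter: neither lies in the convex hull of the other. (Any
elliptical disk is the convex hull of its boundary together with a small off-center ellipse in
its interior, and this does not count.) -/
def IsBiElliptical (W : Set ℂ) : Prop :=
  ∃ (E₁ E₂ : Set ℂ) (c₁ c₂ : ℂ), IsEllipse E₁ c₁ ∧ IsEllipse E₂ c₂ ∧ c₁ ≠ c₂ ∧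
    ¬ E₁ ⊆ convexHull ℝ E₂ ∧ ¬ E₂ ⊆ convexHull ℝ E₁ ∧ W = convexHull ℝ (E₁ ∪ E₂)

/-- The matrix `[[α I, B^* + I], [B - I, -α I]]` with `B = [[b₁, b], [0, b₂]]` and `b` real. -/
def triangularizedMatrix (α b₁ b₂ : ℂ) (b : ℝ) : Matrix (Fin 4) (Fin 4) ℂ :=
  !![α,      0,      star b₁ + 1, 0;
     0,      α,      b,           star b₂ + 1;
     b₁ - 1, b,      -α,          0;
     0,      b₂ - 1, 0,           -α]

/-!
The support function of `W(A)` in the direction `z` is the largest eigenvalue of the Hermitian part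
of `conj z * A` (Kippenhahn), and a compact convex set is determined by its support function. For
the matrix at hand the eigenvalue equation is biquadratic, and an ellipse centered at `c` has the
support function `l + √Q`, where `l = ⟨z, c⟩` and `Q` is a positive definite quadratic form.

If `W(A)` is bi-elliptical, one of the ellipses with `c ≠ 0` supplies the largest eigenvalue in
infinitely many directions of slope `s`. As `Q` is not a square, the conjugate `l - √Q` is an
eigenvalue too, and the biquadratic is the one with the roots `±l ± √Q`; comparing coefficients as
polynomials in `s` gives the conditions. Conversely, under the conditions the biquadratic splits
explicitly, with `l = ± Re z * b / 2`, and the largest root is the support function of the convex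
hull of two translates of the same ellipse.
-/

open Metric Set
open scoped ComplexStarModule InnerProductSpace

section SupportFunction

variable {E : Type*} [NormedAddCommGroup E] [InnerProductSpace ℝ E]

/-- `h` is the support function of `S`: in every direction `z` the maximum of `⟪z, w⟫` over
`w ∈ S` is attained and equals `h z`. -/
def IsSupportFunction (S : Set E) (h : E → ℝ) : Prop :=
  ∀ z, IsGreatest (inner ℝ z '' S) (h z)

namespace IsSupportFunction

variable {S T : Set E} {f g : E → ℝ}

theorem inner_le (hf : IsSupportFunction S f) (z : E) {w : E} (hw : w ∈ S) :
    ⟪z, w⟫_ℝ ≤ f z :=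
  (hf z).2 (mem_image_of_mem _ hw)

protected theorem convexHull (hf : IsSupportFunction S f) :
    IsSupportFunction (convexHull ℝ S) f := by
  refine fun z => ⟨image_mono (subset_convexHull ℝ S) (hf z).1, forall_mem_image.2 fun w hw => ?_⟩
  exact convexHull_min (fun _ => hf.inner_le z)
    (convex_halfSpace_le (innerₗ E z).isLinear (f z)) hw

protected theorem union (hf : IsSupportFunction S f) (hg : IsSupportFunction T g) :
    IsSupportFunction (S ∪ T) fun z => max (f z) (g z) := fun z => by
  rw [image_union]
  exact (hf z).union (hg z)

theorem subset_of_le [CompleteSpace E] (hf : IsSupportFunction S f) (hg : IsSupportFunction T g)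
    (hT : Convex ℝ T) (hT' : IsClosed T) (hfg : ∀ z, f z ≤ g z) : S ⊆ T := by
  intro w hw
  by_contra hwT
  obtain ⟨φ, u, hφT, hφw⟩ := geometric_hahn_banach_closed_point hT hT' hwT
  obtain ⟨z, rfl⟩ := (InnerProductSpace.toDual ℝ E).surjective φ
  simp only [InnerProductSpace.toDual_apply_apply] at hφT hφw
  obtain ⟨k, hk, hkz⟩ := (hg z).1
  linarith [hf.inner_le z hw, hfg z, hφT k hk]

theorem eq_of_convex_of_isClosed [CompleteSpace E] (hf : IsSupportFunction S f)
    (hf' : IsSupportFunction T f) (hS : Convex ℝ S) (hS' : IsClosed S) (hT : Convex ℝ T)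
    (hT' : IsClosed T) : S = T :=
  (hf.subset_of_le hf' hT hT' fun _ => le_rfl).antisymm
    (hf'.subset_of_le hf hS hS' fun _ => le_rfl)

theorem center_eq_of_subset_convexHull {c₁ c₂ : E}
    (hf : IsSupportFunction S fun z => ⟪z, c₁⟫_ℝ + f z)
    (hg : IsSupportFunction T fun z => ⟪z, c₂⟫_ℝ + f z) (hST : S ⊆ convexHull ℝ T) : c₁ = c₂ := by
  obtain ⟨w, hw, hw'⟩ := (hf (c₁ - c₂)).1
  have hle := hg.convexHull.inner_le (c₁ - c₂) (hST hw)
  have hnorm : ⟪c₁ - c₂, c₁ - c₂⟫_ℝ ≤ 0 := by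
    rw [inner_sub_right]
    linarith
  exact sub_eq_zero.1 (real_inner_self_nonpos.1 hnorm)

end IsSupportFunction

/-- By Carathéodory's theorem, convex combinations of boundedly many points suffice. -/
theorem isCompact_convexHull_of_isCompact {S : Set E} [FiniteDimensional ℝ E] (hS : IsCompact S) :
    IsCompact (convexHull ℝ S) := by
  let combinations (k : ℕ) : Set E := (fun p : (Fin k → ℝ) × (Fin k → E) => ∑ i, p.1 i • p.2 i) ''
    stdSimplex ℝ (Fin k) ×ˢ univ.pi fun _ => S
  have hcompact (k : ℕ) : IsCompact (combinations k) :=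
    ((isCompact_stdSimplex ℝ _).prod (isCompact_univ_pi fun _ => hS)).image (by fun_prop)
  suffices convexHull ℝ S = ⋃ k ∈ Finset.range (Module.finrank ℝ E + 2), combinations k by
    rw [this]
    exact Finset.isCompact_biUnion _ fun k _ => hcompact k
  refine Subset.antisymm (fun w hw => ?_) (iUnion₂_subset fun k _ => ?_)
  · obtain ⟨ι, _, p, a, hp, hind, ha, hsum, rfl⟩ := eq_pos_convex_span_of_mem_convexHull hw
    have hcard : Fintype.card ι ≤ Module.finrank ℝ E + 1 := hind.card_le_finrank_succ.trans
      (Nat.add_le_add_right (Submodule.finrank_le _) 1)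
    let e := (Fintype.equivFin ι).symm
    refine mem_biUnion (by simpa [Nat.lt_succ_iff] using hcard)
      ⟨(a ∘ e, p ∘ e), ⟨⟨fun i => (ha _).le, ?_⟩, ?_⟩, ?_⟩
    · exact (e.sum_comp a).trans hsum
    · exact fun i _ => hp (mem_range_self _)
    · exact e.sum_comp fun i => a i • p i
  · rintro _ ⟨⟨a, p⟩, ⟨ha, hp⟩, rfl⟩
    exact (convex_convexHull ℝ S).sum_mem (fun i _ => ha.1 i) ha.2
      fun i _ => subset_convexHull ℝ S (hp i (mem_univ i))

end SupportFunction

section ToeplitzHausdorff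

variable {E : Type*} [NormedAddCommGroup E] [InnerProductSpace ℂ E]

theorem exists_norm_eq_one_mul_im_eq_zero (u : ℂ) : ∃ ω : ℂ, ‖ω‖ = 1 ∧ (ω * u).im = 0 := by
  refine ⟨Complex.exp ((-u.arg : ℝ) * Complex.I), Complex.norm_exp_ofReal_mul_I _, ?_⟩
  conv_lhs => rw [← Complex.norm_mul_exp_arg_mul_I u]
  rw [mul_left_comm, ← Complex.exp_add]
  simp

theorem linearIndependent_pair_of_inner_apply_ne (T : E →ₗ[ℂ] E) {x y : E} (hx : ‖x‖ = 1)
    (hy : ‖y‖ = 1) (hxy : ⟪x, T x⟫_ℂ ≠ ⟪y, T y⟫_ℂ) : LinearIndependent ℂ ![x, y] := by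
  have hx0 : x ≠ 0 := norm_ne_zero_iff.1 (hx ▸ one_ne_zero)
  refine (LinearIndependent.pair_iff' hx0).2 fun ω hω => hxy ?_
  have hω1 : ‖ω‖ = 1 := by rw [← hω, norm_smul, hx, mul_one] at hy; exact hy
  rw [← hω, map_smul, inner_smul_left, inner_smul_right, ← mul_assoc, Complex.conj_mul', hω1]
  simp

theorem exists_norm_eq_one_inner_apply_eq_ofReal (T : E →ₗ[ℂ] E) {x y : E} (hx : ‖x‖ = 1)
    (hy : ‖y‖ = 1) (hTx : ⟪x, T x⟫_ℂ = 0) (hTy : ⟪y, T y⟫_ℂ = 1) {τ : ℝ} (hτ : τ ∈ Icc (0 : ℝ) 1) :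
    ∃ u : E, ‖u‖ = 1 ∧ ⟪u, T u⟫_ℂ = τ := by
  obtain ⟨ω, hω, hωim⟩ := exists_norm_eq_one_mul_im_eq_zero (⟪y, T x⟫_ℂ - star ⟪x, T y⟫_ℂ)
  -- The phase `ω` makes the cross terms of the form on `span {ω • x, y}` add up to a real number.
  obtain ⟨κ, hκ⟩ : ∃ κ : ℝ, star ω * ⟪x, T y⟫_ℂ + ω * ⟪y, T x⟫_ℂ = κ := by
    refine Complex.conj_eq_iff_real.1 (Complex.conj_eq_iff_im.2 (Eq.trans ?_ hωim))
    simp only [Complex.add_im, Complex.mul_im, Complex.sub_im, Complex.sub_re,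
      Complex.star_def, Complex.conj_re, Complex.conj_im]
    ring
  let path (t : ℝ) : E := ((1 - t : ℝ) * ω) • x + (t : ℂ) • y
  have hform (t : ℝ) : ⟪path t, T (path t)⟫_ℂ = (t * (1 - t) * κ + t ^ 2 : ℝ) := by
    simp only [path, map_add, map_smul, inner_add_left, inner_add_right, inner_smul_left,
      inner_smul_right, hTx, hTy, map_mul, Complex.conj_ofReal]
    push_cast
    rw [← hκ, Complex.star_def]
    ring
  have hpath (t : ℝ) : path t ≠ 0 := fun h0 => by
    obtain ⟨h₁, h₂⟩ := LinearIndependent.pair_iff.1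
      (linearIndependent_pair_of_inner_apply_ne T hx hy (by simp [hTx, hTy])) _ _ h0
    simp [Complex.ofReal_eq_zero.1 h₂, norm_ne_zero_iff.1 (hω ▸ one_ne_zero)] at h₁
  have hcont : Continuous fun t => (t * (1 - t) * κ + t ^ 2) / ‖path t‖ ^ 2 :=
    Continuous.div (by fun_prop) (by fun_prop) fun t => pow_ne_zero 2 (norm_ne_zero_iff.2 (hpath t))
  obtain ⟨t, -, ht⟩ := intermediate_value_Icc zero_le_one hcont.continuousOn
    (by simpa [path, hy] using hτ)
  have hnorm : (‖path t‖ : ℂ) ≠ 0 := Complex.ofReal_ne_zero.2 (norm_ne_zero_iff.2 (hpath t))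
  refine ⟨(‖path t‖⁻¹ : ℂ) • path t, norm_smul_inv_norm (hpath t), ?_⟩
  rw [map_smul, inner_smul_left, inner_smul_right, hform, ← ht]
  simp only [map_inv₀, Complex.conj_ofReal]
  push_cast
  field_simp [hnorm]

/-- The Toeplitz–Hausdorff theorem. -/
theorem convex_image_inner_apply_sphere (T : E →ₗ[ℂ] E) :
    Convex ℝ ((fun x => ⟪x, T x⟫_ℂ) '' sphere 0 1) := by
  rw [convex_iff_segment_subset]
  rintro _ ⟨x, hx, rfl⟩ _ ⟨y, hy, rfl⟩
  rw [mem_sphere_zero_iff_norm] at hx hy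
  set a := ⟪x, T x⟫_ℂ with ha
  set b := ⟪y, T y⟫_ℂ with hb
  rw [segment_eq_image']
  rintro _ ⟨τ, hτ, rfl⟩
  rcases eq_or_ne a b with hab | hab
  · exact ⟨x, mem_sphere_zero_iff_norm.2 hx,
      by simp only [← ha, ← hb, hab, sub_self, smul_zero, add_zero]⟩
  have hba : b - a ≠ 0 := sub_ne_zero.2 hab.symm
  let S : E →ₗ[ℂ] E := (b - a)⁻¹ • (T - a • LinearMap.id)
  have hS (u : E) (hu : ‖u‖ = 1) : ⟪u, S u⟫_ℂ = (b - a)⁻¹ * (⟪u, T u⟫_ℂ - a) := by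
    simp only [S, LinearMap.smul_apply, LinearMap.sub_apply, LinearMap.id_apply, inner_smul_right,
      inner_sub_right, inner_self_eq_norm_sq_to_K, hu, Complex.coe_algebraMap, Complex.ofReal_one,
      one_pow, mul_one]
  obtain ⟨u, hu, hSu⟩ := exists_norm_eq_one_inner_apply_eq_ofReal S hx hy
    (by rw [hS x hx, ← ha, sub_self, mul_zero]) (by rw [hS y hy, ← hb, inv_mul_cancel₀ hba]) hτ
  refine ⟨u, mem_sphere_zero_iff_norm.2 hu, ?_⟩
  rw [hS u hu, inv_mul_eq_iff_eq_mul₀ hba] at hSu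
  simp only [Complex.real_smul]
  linear_combination hSu

end ToeplitzHausdorff

section RayleighQuotient

open Module.End

variable {𝕜 E : Type*} [RCLike 𝕜] [NormedAddCommGroup E] [InnerProductSpace 𝕜 E]

theorem mem_image_reApplyInnerSelf_sphere_of_hasEigenvalue {T : E →L[𝕜] E} {μ : ℝ}
    (h : HasEigenvalue (T : E →ₗ[𝕜] E) μ) : μ ∈ T.reApplyInnerSelf '' sphere 0 1 := by
  obtain ⟨x, hx⟩ := h.exists_hasEigenvector
  have hTx : T x = (μ : 𝕜) • x := hx.apply_eq_smul
  have hu : ‖(‖x‖⁻¹ : 𝕜) • x‖ = 1 := norm_smul_inv_norm hx.2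
  refine ⟨(‖x‖⁻¹ : 𝕜) • x, mem_sphere_zero_iff_norm.2 hu, ?_⟩
  rw [ContinuousLinearMap.reApplyInnerSelf_apply, map_smul, hTx, smul_comm, inner_smul_left,
    inner_self_eq_norm_sq_to_K, hu]
  simp

theorem hasEigenvalue_of_isGreatest_reApplyInnerSelf [CompleteSpace E] {T : E →L[𝕜] E}
    (hT : IsSelfAdjoint T) {μ : ℝ} (h : IsGreatest (T.reApplyInnerSelf '' sphere 0 1) μ) :
    HasEigenvalue (T : E →ₗ[𝕜] E) μ := by
  obtain ⟨⟨x, hx, rfl⟩, hmax⟩ := h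
  rw [mem_sphere_zero_iff_norm] at hx
  have hextr : IsLocalExtrOn T.reApplyInnerSelf (sphere 0 ‖x‖) x := by
    refine IsExtrOn.localize (Or.inr fun y hy => hmax (mem_image_of_mem _ ?_))
    rwa [hx] at hy
  have hTx := hT.eq_smul_self_of_isLocalExtrOn hextr
  rw [ContinuousLinearMap.rayleighQuotient, hx, one_pow, div_one] at hTx
  exact hasEigenvalue_of_hasEigenvector
    (hasEigenvector_iff.2 ⟨mem_eigenspace_iff.2 hTx, norm_ne_zero_iff.1 (hx ▸ one_ne_zero)⟩)

theorem isGreatest_image_reApplyInnerSelf_sphere_iff [FiniteDimensional 𝕜 E] [Nontrivial E]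
    {T : E →L[𝕜] E} (hT : (T : E →ₗ[𝕜] E).IsSymmetric) {μ : ℝ} :
    IsGreatest (T.reApplyInnerSelf '' sphere 0 1) μ ↔
      IsGreatest {ν : ℝ | HasEigenvalue (T : E →ₗ[𝕜] E) ν} μ := by
  have := FiniteDimensional.complete 𝕜 E
  have := FiniteDimensional.proper_rclike 𝕜 E
  have hsub : {ν : ℝ | HasEigenvalue (T : E →ₗ[𝕜] E) ν} ⊆ T.reApplyInnerSelf '' sphere 0 1 :=
    fun ν hν => mem_image_reApplyInnerSelf_sphere_of_hasEigenvalue hν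
  have hmono {μ : ℝ} (h : IsGreatest (T.reApplyInnerSelf '' sphere 0 1) μ) :
      IsGreatest {ν : ℝ | HasEigenvalue (T : E →ₗ[𝕜] E) ν} μ :=
    ⟨hasEigenvalue_of_isGreatest_reApplyInnerSelf hT.isSelfAdjoint h, fun ν hν => h.2 (hsub hν)⟩
  refine ⟨hmono, fun h => ?_⟩
  have hne : (sphere (0 : E) 1).Nonempty :=
    nonempty_coe_sort.1 (NormedSpace.sphere_nonempty_rclike 𝕜 zero_le_one)
  obtain ⟨m, hm⟩ := ((isCompact_sphere (0 : E) 1).image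
    T.reApplyInnerSelf_continuous).exists_isGreatest (hne.image _)
  rwa [h.unique (hmono hm)]

end RayleighQuotient

section NumericalRange

variable {n : Type*} [Fintype n]

theorem numericalRange_eq_image [DecidableEq n] (A : Matrix n n ℂ) :
    numericalRange A = (fun x => ⟪x, Matrix.toEuclideanCLM (𝕜 := ℂ) A x⟫_ℂ) '' sphere 0 1 := by
  ext w
  simp only [mem_image, mem_sphere_zero_iff_norm]
  rfl

theorem convex_numericalRange (A : Matrix n n ℂ) : Convex ℝ (numericalRange A) := by
  classical
  rw [numericalRange_eq_image]
  exact convex_image_inner_apply_sphere (Matrix.toEuclideanCLM (𝕜 := ℂ) A).toLinearMap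

theorem isCompact_numericalRange (A : Matrix n n ℂ) : IsCompact (numericalRange A) := by
  classical
  rw [numericalRange_eq_image]
  exact (isCompact_sphere _ _).image (by fun_prop)

theorem reApplyInnerSelf_realPart {E : Type*} [NormedAddCommGroup E] [InnerProductSpace ℂ E]
    [CompleteSpace E] (T : E →L[ℂ] E) (x : E) :
    (ℜ T : E →L[ℂ] E).reApplyInnerSelf x = RCLike.re ⟪x, T x⟫_ℂ := by
  rw [ContinuousLinearMap.reApplyInnerSelf_apply, realPart_apply_coe, smul_apply, add_apply,
    ContinuousLinearMap.star_eq_adjoint, inner_smul_left_eq_smul, inner_add_left,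
    ContinuousLinearMap.adjoint_inner_left, RCLike.smul_re, map_add, inner_re_symm (T x) x]
  ring

theorem mem_spectrum_real_iff_hasEigenvalue [DecidableEq n] (A : Matrix n n ℂ) (t : ℝ) :
    t ∈ spectrum ℝ A ↔
      Module.End.HasEigenvalue (Matrix.toEuclideanCLM (𝕜 := ℂ) A).toLinearMap (t : ℂ) := by
  rw [Module.End.hasEigenvalue_iff_mem_spectrum, ← spectrum.algebraMap_mem_iff ℂ,
    Matrix.coe_toEuclideanCLM_eq_toEuclideanLin, Matrix.spectrum_toLpLin]
  rfl

/-- Kippenhahn's theorem: the support function of the numerical range in the direction `z` is the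
largest eigenvalue of the Hermitian part of `star z • A`. -/
theorem isSupportFunction_numericalRange_iff [DecidableEq n] [Nonempty n] (A : Matrix n n ℂ)
    {h : ℂ → ℝ} : IsSupportFunction (numericalRange A) h ↔
      ∀ z, IsGreatest (spectrum ℝ (ℜ (star z • A) : Matrix n n ℂ)) (h z) := by
  refine forall_congr' fun z => ?_
  let T := Matrix.toEuclideanCLM (𝕜 := ℂ) (ℜ (star z • A) : Matrix n n ℂ)
  have hT : T = ℜ (Matrix.toEuclideanCLM (𝕜 := ℂ) (star z • A)) := map_realPart _ _
  have hsymm : T.toLinearMap.IsSymmetric :=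
    ContinuousLinearMap.isSelfAdjoint_iff_isSymmetric.1 (hT ▸ (ℜ _).2)
  have hvalues : inner ℝ z '' numericalRange A = T.reApplyInnerSelf '' sphere 0 1 := by
    rw [numericalRange_eq_image, image_image, hT]
    refine image_congr fun x _ => ?_
    rw [reApplyInnerSelf_realPart, map_smul, smul_apply, inner_smul_right, Complex.inner, mul_comm,
      Complex.star_def]
    rfl
  have hspec : spectrum ℝ (ℜ (star z • A) : Matrix n n ℂ) =
      {t : ℝ | Module.End.HasEigenvalue T.toLinearMap t} :=
    ext fun t => mem_spectrum_real_iff_hasEigenvalue _ t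
  rw [hvalues, hspec, isGreatest_image_reApplyInnerSelf_sphere_iff hsymm]
  rfl

end NumericalRange

section Ellipse

/-- The quadratic form `z ↦ τ * ‖z‖ ^ 2 + Re (conj ζ * z ^ 2)`, which is positive definite if
`‖ζ‖ < τ`. Its square root is then the support function of the ellipse around `0` whose semi-axes
have the squares `τ + ‖ζ‖` and `τ - ‖ζ‖`, the first one in the direction `arg ζ / 2`. -/
noncomputable def ellipseForm (τ : ℝ) (ζ z : ℂ) : ℝ :=
  τ * ‖z‖ ^ 2 + (star ζ * z ^ 2).re

theorem ellipseForm_eq (τ : ℝ) (ζ z : ℂ) : ellipseForm τ ζ z =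
    (τ + ζ.re) * z.re ^ 2 + 2 * ζ.im * (z.re * z.im) + (τ - ζ.re) * z.im ^ 2 := by
  rw [ellipseForm, ← Complex.normSq_eq_norm_sq, Complex.normSq_apply]
  simp only [sq, Complex.star_def, Complex.mul_re, Complex.conj_re, Complex.conj_im, Complex.mul_im]
  ring

theorem mul_sq_norm_le_ellipseForm (τ : ℝ) (ζ z : ℂ) :
    (τ - ‖ζ‖) * ‖z‖ ^ 2 ≤ ellipseForm τ ζ z := by
  have hre := neg_le_of_abs_le (Complex.abs_re_le_norm (star ζ * z ^ 2))
  rw [norm_mul, norm_star, norm_pow] at hre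
  rw [ellipseForm]
  linarith

theorem ellipseForm_nonneg {τ : ℝ} {ζ : ℂ} (h : ‖ζ‖ ≤ τ) (z : ℂ) : 0 ≤ ellipseForm τ ζ z :=
  (mul_nonneg (sub_nonneg.2 h) (sq_nonneg _)).trans (mul_sq_norm_le_ellipseForm τ ζ z)

theorem ellipseForm_pos {τ : ℝ} {ζ z : ℂ} (h : ‖ζ‖ < τ) (hz : z ≠ 0) : 0 < ellipseForm τ ζ z :=
  (mul_pos (sub_pos.2 h) (pow_pos (norm_pos_iff.2 hz) 2)).trans_le
    (mul_sq_norm_le_ellipseForm τ ζ z)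

@[fun_prop]
theorem continuous_ellipseForm (τ : ℝ) (ζ : ℂ) : Continuous (ellipseForm τ ζ) := by
  unfold ellipseForm
  fun_prop

theorem isGreatest_inner_exp_mul_I (w : ℂ) :
    IsGreatest (range fun t : ℝ => ⟪w, Complex.exp (t * Complex.I)⟫_ℝ) ‖w‖ := by
  refine ⟨⟨w.arg, ?_⟩, forall_mem_range.2 fun t => ?_⟩
  · nth_rw 1 [← Complex.norm_mul_exp_arg_mul_I w]
    beta_reduce
    rw [← Complex.real_smul, real_inner_smul_left, real_inner_self_eq_norm_sq,
      Complex.norm_exp_ofReal_mul_I, one_pow, mul_one]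
  · simpa only [Complex.norm_exp_ofReal_mul_I, mul_one] using
      real_inner_le_norm w (Complex.exp (t * Complex.I))

theorem ellipseForm_mul (τ : ℝ) (ζ z : ℂ) {ω : ℂ} (hω : ‖ω‖ = 1) :
    ellipseForm τ (ζ * ω ^ 2) (ω * z) = ellipseForm τ ζ z := by
  have hstar : star (ζ * ω ^ 2) * (ω * z) ^ 2 = (star ω * ω) ^ 2 * (star ζ * z ^ 2) := by
    rw [star_mul', star_pow]
    ring
  rw [ellipseForm, ellipseForm, norm_mul, hω, one_mul, hstar, Complex.star_def, Complex.conj_mul',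
    hω]
  simp

theorem inner_mul_mul_of_norm_eq_one (u w : ℂ) {ω : ℂ} (hω : ‖ω‖ = 1) :
    ⟪ω * u, ω * w⟫_ℝ = ⟪u, w⟫_ℝ := by
  rw [Complex.inner, Complex.inner, map_mul, mul_mul_mul_comm, Complex.mul_conj', hω]
  simp

theorem isSupportFunction_ellipse (c : ℂ) (φ r s : ℝ) :
    IsSupportFunction (range fun t : ℝ =>
        c + Complex.exp (φ * Complex.I) * ⟨r * Real.cos t, s * Real.sin t⟩)
      fun z => ⟪z, c⟫_ℝ + √(ellipseForm ((r ^ 2 + s ^ 2) / 2)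
        (((r ^ 2 - s ^ 2) / 2 : ℝ) * Complex.exp (φ * Complex.I) ^ 2) z) := by
  have hω : ‖Complex.exp (φ * Complex.I)‖ = 1 := Complex.norm_exp_ofReal_mul_I φ
  set ω := Complex.exp (φ * Complex.I)
  intro z
  obtain ⟨u, rfl⟩ : ∃ u, z = ω * u :=
    ⟨ω⁻¹ * z, (mul_inv_cancel_left₀ (Complex.exp_ne_zero _) z).symm⟩
  have hform : √(ellipseForm ((r ^ 2 + s ^ 2) / 2) (((r ^ 2 - s ^ 2) / 2 : ℝ) * ω ^ 2) (ω * u)) =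
      ‖(⟨r * u.re, s * u.im⟩ : ℂ)‖ := by
    rw [ellipseForm_mul _ _ _ hω, ellipseForm_eq, Complex.norm_def, Complex.normSq_mk,
      Complex.ofReal_re, Complex.ofReal_im]
    ring_nf
  have hinner (t : ℝ) : ⟪ω * u, c + ω * ⟨r * Real.cos t, s * Real.sin t⟩⟫_ℝ =
      ⟪ω * u, c⟫_ℝ + ⟪(⟨r * u.re, s * u.im⟩ : ℂ), Complex.exp (t * Complex.I)⟫_ℝ := by
    rw [inner_add_right, inner_mul_mul_of_norm_eq_one _ _ hω]
    congr 1
    simp only [Complex.inner, Complex.mul_re, Complex.conj_re, Complex.conj_im,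
      Complex.exp_ofReal_mul_I_re, Complex.exp_ofReal_mul_I_im]
    ring
  simp only [← range_comp, Function.comp_def, hform, hinner]
  have hmono : Monotone (⟪ω * u, c⟫_ℝ + ·) := fun _ _ h => add_le_add_right h _
  simpa only [← range_comp, Function.comp_def] using
    hmono.map_isGreatest (isGreatest_inner_exp_mul_I ⟨r * u.re, s * u.im⟩)

variable {E : Set ℂ} {c : ℂ}

theorem IsEllipse.isCompact (h : IsEllipse E c) : IsCompact E := by
  obtain ⟨φ, r, s, -, -, rfl⟩ := h
  refine Function.Periodic.compact_of_continuous (c := 2 * Real.pi) (fun t => ?_)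
    Real.two_pi_pos.ne' ?_
  · simp only [Real.cos_add_two_pi, Real.sin_add_two_pi]
  · simp only [Complex.mk_eq_add_mul_I]
    fun_prop

theorem IsEllipse.exists_isSupportFunction (h : IsEllipse E c) : ∃ τ ζ, ‖ζ‖ < τ ∧
    IsSupportFunction E fun z => ⟪z, c⟫_ℝ + √(ellipseForm τ ζ z) := by
  obtain ⟨φ, r, s, hr, hs, rfl⟩ := h
  refine ⟨_, _, ?_, isSupportFunction_ellipse c φ r s⟩
  rw [norm_mul, norm_pow, Complex.norm_exp_ofReal_mul_I, one_pow, mul_one, Complex.norm_real,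
    Real.norm_eq_abs, abs_lt]
  constructor <;> nlinarith [sq_pos_of_pos hr, sq_pos_of_pos hs]

theorem exists_isEllipse_isSupportFunction {τ : ℝ} {ζ : ℂ} (h : ‖ζ‖ < τ) (c : ℂ) :
    ∃ E, IsEllipse E c ∧ IsSupportFunction E fun z => ⟪z, c⟫_ℝ + √(ellipseForm τ ζ z) := by
  have hr : 0 < τ + ‖ζ‖ := by linarith [norm_nonneg ζ]
  have hs : 0 < τ - ‖ζ‖ := sub_pos.2 h
  refine ⟨_, ⟨ζ.arg / 2, √(τ + ‖ζ‖), √(τ - ‖ζ‖), Real.sqrt_pos.2 hr, Real.sqrt_pos.2 hs, rfl⟩, ?_⟩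
  convert isSupportFunction_ellipse c (ζ.arg / 2) √(τ + ‖ζ‖) √(τ - ‖ζ‖) using 5
  · rw [Real.sq_sqrt hr.le, Real.sq_sqrt hs.le]
    ring
  · rw [Real.sq_sqrt hr.le, Real.sq_sqrt hs.le, ← Complex.exp_nat_mul]
    nth_rw 1 [← Complex.norm_mul_exp_arg_mul_I ζ]
    push_cast
    ring_nf

end Ellipse

section KippenhahnPolynomial

/-- The characteristic polynomial in `t` of the Hermitian part of `star z • A`, where `A` is
`triangularizedMatrix (v * I) b₁ b₂ b`. It is biquadratic in `t`. -/
noncomputable def kippenhahnPoly (v : ℝ) (b₁ b₂ : ℂ) (b : ℝ) (z : ℂ) (t : ℝ) : ℝ :=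
  (t ^ 2 - v ^ 2 * z.im ^ 2 - Complex.normSq (z.re * b₁ + z.im * Complex.I)) *
      (t ^ 2 - v ^ 2 * z.im ^ 2 - Complex.normSq (z.re * b₂ + z.im * Complex.I)) -
    b ^ 2 * z.re ^ 2 * (t ^ 2 - v ^ 2 * z.im ^ 2)

theorem realPart_star_smul_triangularizedMatrix (v : ℝ) (b₁ b₂ : ℂ) (b : ℝ) (z : ℂ) :
    (ℜ (star z • triangularizedMatrix (v * Complex.I) b₁ b₂ b) : Matrix (Fin 4) (Fin 4) ℂ) =
      !![(z.im * v : ℂ), 0, star (z.re * b₁ + z.im * Complex.I), 0;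
         0, z.im * v, z.re * b, star (z.re * b₂ + z.im * Complex.I);
         z.re * b₁ + z.im * Complex.I, z.re * b, -(z.im * v), 0;
         0, z.re * b₂ + z.im * Complex.I, 0, -(z.im * v)] := by
  rw [realPart_apply_coe]
  ext i j
  fin_cases i <;> fin_cases j <;> apply Complex.ext <;>
    simp [triangularizedMatrix, Matrix.star_apply] <;> ring

theorem spectrum_realPart_star_smul_triangularizedMatrix (v : ℝ) (b₁ b₂ : ℂ) (b : ℝ) (z : ℂ) :
    spectrum ℝ (ℜ (star z • triangularizedMatrix (v * Complex.I) b₁ b₂ b) :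
      Matrix (Fin 4) (Fin 4) ℂ) = {t | kippenhahnPoly v b₁ b₂ b z t = 0} := by
  ext t
  rw [mem_ofPred_eq, spectrum.mem_iff, Matrix.isUnit_iff_isUnit_det, isUnit_iff_ne_zero, not_not,
    realPart_star_smul_triangularizedMatrix, ← Complex.ofReal_eq_zero]
  refine Eq.congr_left ?_
  rw [kippenhahnPoly]
  push_cast
  rw [← Complex.mul_conj, ← Complex.mul_conj]
  generalize (z.re * b₁ + z.im * Complex.I : ℂ) = β₁
  generalize (z.re * b₂ + z.im * Complex.I : ℂ) = β₂
  simp [Matrix.det_succ_row_zero, Fin.sum_univ_succ, Fin.succAbove, Matrix.algebraMap_matrix_apply]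
  ring

end KippenhahnPolynomial

section Biquadratic

open Polynomial

theorem eq_zero_of_sq_eq_sq_mul {R : Type*} [CommRing R] [IsDomain R] [IsIntegrallyClosed R]
    {a b q : R} (hq : ¬IsSquare q) (h : a ^ 2 = b ^ 2 * q) : b = 0 := by
  by_contra hb
  obtain ⟨g, rfl⟩ := (IsIntegrallyClosed.pow_dvd_pow_iff two_ne_zero).1 ⟨q, h⟩
  rw [mul_pow] at h
  exact hq ⟨g, by rw [← sq, mul_left_cancel₀ (pow_ne_zero 2 hb) h]⟩

/-- If `l + √Q` is a root of `t ^ 4 - P t ^ 2 + N`, then so is its conjugate `l - √Q`. -/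
theorem biquadratic_coeff_eq_of_infinite {K : Type*} [Field K] (h2 : (2 : K) ≠ 0)
    {l Q P N : K[X]} (hl : l ≠ 0) (hQ : ¬IsSquare Q)
    (h : {z | ∃ r, r ^ 2 = Q.eval z ∧
      (l.eval z + r) ^ 4 - P.eval z * (l.eval z + r) ^ 2 + N.eval z = 0}.Infinite) :
    P = 2 * (l ^ 2 + Q) ∧ N = (l ^ 2 - Q) ^ 2 := by
  obtain ⟨G₀, hG₀⟩ : ∃ G₀, G₀ = (l ^ 2 + Q) ^ 2 + 4 * l ^ 2 * Q - P * (l ^ 2 + Q) + N := ⟨_, rfl⟩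
  obtain ⟨G₁, hG₁⟩ : ∃ G₁, G₁ = 2 * l * (2 * (l ^ 2 + Q) - P) := ⟨_, rfl⟩
  -- At `t = l + r` with `r ^ 2 = Q` the biquadratic takes the value `G₀ + G₁ * r`.
  have hsq : G₀ ^ 2 = G₁ ^ 2 * Q := by
    refine eq_of_infinite_eval_eq _ _ (h.mono fun z hz => ?_)
    obtain ⟨r, hr, hz⟩ := hz
    have hroot : G₀.eval z + G₁.eval z * r = 0 := by
      simp only [hG₀, hG₁, eval_add, eval_sub, eval_mul, eval_pow, eval_ofNat, ← hr]
      linear_combination hz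
    simp only [mem_ofPred_eq, eval_mul, eval_pow, ← hr]
    linear_combination (G₀.eval z - G₁.eval z * r) * hroot
  have hG₁0 : G₁ = 0 := eq_zero_of_sq_eq_sq_mul hQ hsq
  have hG₀0 : G₀ = 0 := by simpa [hG₁0] using hsq
  have hP : P = 2 * (l ^ 2 + Q) := by
    have h2l : 2 * l ≠ 0 := mul_ne_zero (map_ofNat (C : K →+* K[X]) 2 ▸ C_ne_zero.2 h2) hl
    exact (sub_eq_zero.1 ((mul_eq_zero.1 (hG₁.symm.trans hG₁0)).resolve_left h2l)).symm
  refine ⟨hP, ?_⟩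
  rw [hP] at hG₀
  linear_combination hG₀0 - hG₀

theorem not_isSquare_of_natDegree_eq_two {K : Type*} [Field K] {Q : K[X]}
    (hdeg : Q.natDegree = 2) (hroot : ∀ z, ¬Q.IsRoot z) : ¬IsSquare Q :=
  (irreducible_of_degree_le_three_of_not_isRoot (by simp [hdeg]) hroot).not_isSquare

end Biquadratic

section Splitting

theorem exists_infinite_setOf_mul_one_add_mul_I_mem {U : Set ℂ} (hU : IsOpen U)
    (hne : U.Nonempty) :
    ∃ x : ℝ, x ≠ 0 ∧ {s : ℝ | (x : ℂ) * (1 + s * Complex.I) ∈ U}.Infinite := by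
  obtain ⟨z, hzU, hz : z.re ≠ 0⟩ :=
    ((dense_compl_singleton (0 : ℝ)).preimage Complex.isOpenMap_re).inter_open_nonempty U hU hne
  refine ⟨z.re, hz, infinite_of_mem_nhds (z.im / z.re) ?_⟩
  refine (hU.preimage (by fun_prop)).mem_nhds ?_
  rw [mem_preimage]
  convert hzU
  apply Complex.ext <;> simp [mul_div_cancel₀ _ hz]

theorem kippenhahnPoly_mul (v b x t : ℝ) (b₁ b₂ z : ℂ) :
    kippenhahnPoly v b₁ b₂ b (x * z) (x * t) = x ^ 4 * kippenhahnPoly v b₁ b₂ b z t := by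
  have hnormSq (β : ℂ) : Complex.normSq (x * z.re * β + x * z.im * Complex.I) =
      x ^ 2 * Complex.normSq (z.re * β + z.im * Complex.I) := by
    rw [mul_assoc, mul_assoc, ← mul_add, Complex.normSq_mul, Complex.normSq_ofReal, sq]
  simp only [kippenhahnPoly, Complex.re_ofReal_mul, Complex.im_ofReal_mul, Complex.ofReal_mul,
    hnormSq]
  ring

theorem ellipseForm_ofReal_mul (τ x : ℝ) (ζ z : ℂ) :
    ellipseForm τ ζ (x * z) = x ^ 2 * ellipseForm τ ζ z := by
  simp only [ellipseForm_eq, Complex.re_ofReal_mul, Complex.im_ofReal_mul]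
  ring

theorem exists_sq_eq_ellipseForm_of_kippenhahnPoly_mul_eq_zero {v b x τ : ℝ} {b₁ b₂ c ζ z : ℂ}
    (hx : x ≠ 0) (hζ : ‖ζ‖ ≤ τ)
    (h : kippenhahnPoly v b₁ b₂ b (x * z) (⟪x * z, c⟫_ℝ + √(ellipseForm τ ζ (x * z))) = 0) :
    ∃ r, r ^ 2 = ellipseForm τ ζ z ∧ kippenhahnPoly v b₁ b₂ b z (⟪z, c⟫_ℝ + r) = 0 := by
  refine ⟨√(ellipseForm τ ζ (x * z)) / x, ?_, ?_⟩
  · rw [div_pow, Real.sq_sqrt (ellipseForm_nonneg hζ _), ellipseForm_ofReal_mul,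
      mul_div_cancel_left₀ _ (pow_ne_zero 2 hx)]
  · refine (mul_eq_zero.1 ?_).resolve_left (pow_ne_zero 4 hx)
    rwa [← kippenhahnPoly_mul, mul_add, mul_div_cancel₀ _ hx, ← real_inner_smul_left,
      Complex.real_smul]

theorem ellipseForm_one_add_mul_I (τ s : ℝ) (ζ : ℂ) : ellipseForm τ ζ (1 + s * Complex.I) =
    (τ - ζ.re) * s ^ 2 + 2 * ζ.im * s + (τ + ζ.re) := by
  simp [ellipseForm_eq]
  ring

theorem normSq_add_ofReal_mul_I (β : ℂ) (s : ℝ) :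
    Complex.normSq (β + s * Complex.I) = s ^ 2 + 2 * β.im * s + Complex.normSq β := by
  simp [Complex.normSq_apply]
  ring

theorem kippenhahnPoly_one_add_mul_I (v b s t : ℝ) (b₁ b₂ : ℂ) :
    kippenhahnPoly v b₁ b₂ b (1 + s * Complex.I) t =
      (t ^ 2 - v ^ 2 * s ^ 2 - Complex.normSq (b₁ + s * Complex.I)) *
        (t ^ 2 - v ^ 2 * s ^ 2 - Complex.normSq (b₂ + s * Complex.I)) -
      b ^ 2 * (t ^ 2 - v ^ 2 * s ^ 2) := by
  simp [kippenhahnPoly]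

open Polynomial in
/-- With the root `l + √Q`, where `l` and `Q` are polynomials in the slope `s` of the direction and
`Q` is not a square, the biquadratic has the four roots `±l ± √Q`. -/
theorem kippenhahnPoly_splitting {v b τ : ℝ} {b₁ b₂ c ζ : ℂ} (hc : c ≠ 0) (hζ : ‖ζ‖ < τ)
    (h : {s : ℝ | ∃ r, r ^ 2 = ellipseForm τ ζ (1 + s * Complex.I) ∧
      kippenhahnPoly v b₁ b₂ b (1 + s * Complex.I) (⟪1 + s * Complex.I, c⟫_ℝ + r) = 0}.Infinite)
    (s : ℝ) :
    Complex.normSq (b₁ + s * Complex.I) + Complex.normSq (b₂ + s * Complex.I) + b ^ 2 +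
        2 * v ^ 2 * s ^ 2 =
      2 * ((c.re + c.im * s) ^ 2 + ellipseForm τ ζ (1 + s * Complex.I)) ∧
    (v ^ 2 * s ^ 2 + Complex.normSq (b₁ + s * Complex.I)) *
        (v ^ 2 * s ^ 2 + Complex.normSq (b₂ + s * Complex.I)) + b ^ 2 * (v ^ 2 * s ^ 2) =
      ((c.re + c.im * s) ^ 2 - ellipseForm τ ζ (1 + s * Complex.I)) ^ 2 := by
  let l : ℝ[X] := C c.re + C c.im * X
  let Q : ℝ[X] := C (τ - ζ.re) * X ^ 2 + C (2 * ζ.im) * X + C (τ + ζ.re)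
  let D (β : ℂ) : ℝ[X] := X ^ 2 + C (2 * β.im) * X + C (Complex.normSq β)
  let W : ℝ[X] := C (v ^ 2) * X ^ 2
  have hl (s : ℝ) : l.eval s = ⟪1 + s * Complex.I, c⟫_ℝ := by
    simp [l, Complex.inner]
  have hQ (s : ℝ) : Q.eval s = ellipseForm τ ζ (1 + s * Complex.I) := by
    simp [Q, ellipseForm_one_add_mul_I]
  have hD (β : ℂ) (s : ℝ) : (D β).eval s = Complex.normSq (β + s * Complex.I) := by
    simp [D, normSq_add_ofReal_mul_I]
  have hl0 : l ≠ 0 := fun h0 => hc <| Complex.ext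
    (by simpa [l] using congrArg (coeff · 0) h0) (by simpa [l] using congrArg (coeff · 1) h0)
  have hQsq : ¬IsSquare Q := by
    refine not_isSquare_of_natDegree_eq_two (natDegree_quadratic ?_) fun s => ?_
    · exact sub_ne_zero.2 ((Complex.re_le_norm ζ).trans_lt hζ).ne'
    · rw [IsRoot, hQ]
      exact (ellipseForm_pos hζ fun h0 => by simpa using congrArg Complex.re h0).ne'
  have hinf : {s | ∃ r, r ^ 2 = Q.eval s ∧ (l.eval s + r) ^ 4 -
      (D b₁ + D b₂ + C (b ^ 2) + 2 * W).eval s * (l.eval s + r) ^ 2 +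
        ((W + D b₁) * (W + D b₂) + C (b ^ 2) * W).eval s = 0}.Infinite := by
    refine h.mono fun s hs => ?_
    obtain ⟨r, hr, hs⟩ := hs
    refine ⟨r, hr.trans (hQ s).symm, ?_⟩
    rw [kippenhahnPoly_one_add_mul_I] at hs
    simp only [hl, hD, W, eval_add, eval_mul, eval_pow, eval_C, eval_X, eval_ofNat]
    linear_combination hs
  obtain ⟨hP, hN⟩ := biquadratic_coeff_eq_of_infinite two_ne_zero hl0 hQsq hinf
  replace hP := congrArg (eval s) hP
  replace hN := congrArg (eval s) hN
  simp only [hQ, hD, l, W, eval_add, eval_sub, eval_mul, eval_pow, eval_C, eval_X,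
    eval_ofNat] at hP hN
  exact ⟨by linear_combination hP, hN⟩

/-- The identity at the zero `s` of `normSq (b₁ + s I) - normSq (b₂ + s I)` excludes `m ≠ 0`. -/
theorem normSq_eq_and_im_sub_im_sq_eq {b₁ b₂ : ℂ} {m κ : ℝ} (hκ : 0 < κ)
    (h : ∀ s : ℝ, (Complex.normSq (b₁ + s * Complex.I) - Complex.normSq (b₂ + s * Complex.I)) ^ 2 =
      2 * m * (Complex.normSq (b₁ + s * Complex.I) + Complex.normSq (b₂ + s * Complex.I)) -
        m ^ 2 + 4 * κ * s ^ 2) :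
    m = 0 ∧ Complex.normSq b₁ = Complex.normSq b₂ ∧ (b₁.im - b₂.im) ^ 2 = κ := by
  obtain ⟨δ, hδ⟩ : ∃ δ, δ = b₁.im - b₂.im := ⟨_, rfl⟩
  have h₁ := Complex.normSq_nonneg b₁
  have h₂ := Complex.normSq_nonneg b₂
  have hdiff (s : ℝ) : Complex.normSq (b₁ + s * Complex.I) - Complex.normSq (b₂ + s * Complex.I) =
      2 * δ * s + (Complex.normSq b₁ - Complex.normSq b₂) := by
    rw [normSq_add_ofReal_mul_I, normSq_add_ofReal_mul_I, hδ]
    ring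
  have hconst : (Complex.normSq b₁ - Complex.normSq b₂) ^ 2 =
      2 * m * (Complex.normSq b₁ + Complex.normSq b₂) - m ^ 2 := by
    simpa using h 0
  have hsecond : δ ^ 2 = m + κ := by
    have hpos := h 1
    have hneg := h (-1)
    rw [hdiff] at hpos hneg
    simp only [normSq_add_ofReal_mul_I] at hpos hneg
    linarith
  suffices hm : m = 0 by
    refine ⟨hm, ?_, ?_⟩
    · simpa [hm, sub_eq_zero] using hconst
    · rw [← hδ, hsecond, hm, zero_add]
  by_contra hm
  have hm0 : 0 < m := by
    refine lt_of_le_of_ne (not_lt.1 fun hlt => ?_) (Ne.symm hm)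
    nlinarith [sq_nonneg (Complex.normSq b₁ - Complex.normSq b₂), sq_pos_of_neg hlt]
  have hδ0 : δ ≠ 0 := fun h0 => by
    rw [h0] at hsecond
    linarith
  obtain ⟨s, hs⟩ : ∃ s, 2 * δ * s + (Complex.normSq b₁ - Complex.normSq b₂) = 0 :=
    ⟨-(Complex.normSq b₁ - Complex.normSq b₂) / (2 * δ), by field_simp; ring⟩
  have hle : δ ^ 2 / 2 ≤
      Complex.normSq (b₁ + s * Complex.I) + Complex.normSq (b₂ + s * Complex.I) := by
    have him (β : ℂ) : (β.im + s) ^ 2 ≤ Complex.normSq (β + s * Complex.I) := by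
      simpa [sq] using Complex.im_sq_le_normSq (β + s * Complex.I)
    linarith [him b₁, him b₂, sq_nonneg (b₁.im + s + (b₂.im + s)),
      congrArg (· ^ 2) hδ]
  have hroot := h s
  rw [hdiff, hs] at hroot
  nlinarith [mul_nonneg hκ.le (sq_nonneg s), mul_pos hm0 hκ]

theorem conditions_of_kippenhahnPoly_splitting {v b τ p q : ℝ} {b₁ b₂ ζ : ℂ} (hv : v ≠ 0)
    (hζ : ‖ζ‖ < τ) (hpq : p ≠ 0 ∨ q ≠ 0)
    (h : ∀ s : ℝ, Complex.normSq (b₁ + s * Complex.I) + Complex.normSq (b₂ + s * Complex.I) +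
        b ^ 2 + 2 * v ^ 2 * s ^ 2 =
      2 * ((p + q * s) ^ 2 + ellipseForm τ ζ (1 + s * Complex.I)) ∧
    (v ^ 2 * s ^ 2 + Complex.normSq (b₁ + s * Complex.I)) *
        (v ^ 2 * s ^ 2 + Complex.normSq (b₂ + s * Complex.I)) + b ^ 2 * (v ^ 2 * s ^ 2) =
      ((p + q * s) ^ 2 - ellipseForm τ ζ (1 + s * Complex.I)) ^ 2) :
    b ≠ 0 ∧ Complex.normSq b₁ = Complex.normSq b₂ ∧ v ^ 2 * b ^ 2 = (b₁.im - b₂.im) ^ 2 := by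
  have hdisc (s : ℝ) : (Complex.normSq (b₁ + s * Complex.I) + Complex.normSq (b₂ + s * Complex.I) +
        b ^ 2) ^ 2 -
        4 * (Complex.normSq (b₁ + s * Complex.I) * Complex.normSq (b₂ + s * Complex.I)) =
      16 * (p + q * s) ^ 2 * ellipseForm τ ζ (1 + s * Complex.I) := by
    obtain ⟨hP, hN⟩ := h s
    linear_combination (Complex.normSq (b₁ + s * Complex.I) +
      Complex.normSq (b₂ + s * Complex.I) + b ^ 2 + 2 * v ^ 2 * s ^ 2 +
        2 * ((p + q * s) ^ 2 + ellipseForm τ ζ (1 + s * Complex.I))) * hP - 4 * hN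
  have hq : q = 0 := by
    have hζre : 0 < τ - ζ.re := sub_pos.2 ((Complex.re_le_norm ζ).trans_lt hζ)
    -- The left-hand side of `hdisc` is quadratic in `s`, so its fourth differences vanish.
    have hquartic : q ^ 2 * (τ - ζ.re) = 0 := by
      have hquadratic (s : ℝ) := hdisc s
      simp only [normSq_add_ofReal_mul_I, ellipseForm_one_add_mul_I] at hquadratic
      linear_combination (-hquadratic 2 + 4 * hquadratic 1 - 6 * hquadratic 0 +
        4 * hquadratic (-1) - hquadratic (-2)) / 384
    simpa [hζre.ne'] using hquartic
  subst hq
  have hp : p ≠ 0 := hpq.resolve_right (by simp)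
  obtain ⟨hm, hnormSq, hκ⟩ := normSq_eq_and_im_sub_im_sq_eq (b₁ := b₁) (b₂ := b₂)
    (m := 4 * p ^ 2 - b ^ 2) (κ := 4 * p ^ 2 * v ^ 2) (by positivity) fun s => by
      linear_combination hdisc s - 8 * p ^ 2 * (h s).1
  have hb : b ^ 2 = 4 * p ^ 2 := by linarith
  exact ⟨pow_ne_zero_iff two_ne_zero |>.1 (by rw [hb]; positivity), hnormSq, by rw [hκ, hb]; ring⟩

theorem conditions_of_numericalRange_eq_convexHull {v b : ℝ} {b₁ b₂ c₁ c₂ : ℂ} {E₁ E₂ : Set ℂ}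
    (hv : v ≠ 0) (h₁ : IsEllipse E₁ c₁) (h₂ : IsEllipse E₂ c₂) (hc : c₁ ≠ 0)
    (hsub : ¬E₁ ⊆ convexHull ℝ E₂)
    (hW : numericalRange (triangularizedMatrix (v * Complex.I) b₁ b₂ b) =
      convexHull ℝ (E₁ ∪ E₂)) :
    b ≠ 0 ∧ Complex.normSq b₁ = Complex.normSq b₂ ∧ v ^ 2 * b ^ 2 = (b₁.im - b₂.im) ^ 2 := by
  obtain ⟨τ, ζ, hζ, hf⟩ := h₁.exists_isSupportFunction
  obtain ⟨τ₂, ζ₂, -, hg⟩ := h₂.exists_isSupportFunction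
  set f : ℂ → ℝ := fun z => ⟪z, c₁⟫_ℝ + √(ellipseForm τ ζ z)
  set g : ℂ → ℝ := fun z => ⟪z, c₂⟫_ℝ + √(ellipseForm τ₂ ζ₂ z)
  obtain ⟨w, hw⟩ : ∃ w, g w < f w := by
    contrapose! hsub
    exact hf.subset_of_le hg.convexHull (convex_convexHull ℝ E₂)
      (isCompact_convexHull_of_isCompact h₂.isCompact).isClosed hsub
  have hopen : IsOpen {z | g z < f z} := isOpen_lt (by fun_prop) (by fun_prop)
  have hroot : ∀ z, g z < f z → kippenhahnPoly v b₁ b₂ b z (f z) = 0 := fun z hz => by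
    have hspec := ((isSupportFunction_numericalRange_iff _).1 (hW ▸ (hf.union hg).convexHull) z).1
    rwa [spectrum_realPart_star_smul_triangularizedMatrix, max_eq_left hz.le] at hspec
  obtain ⟨x, hx, hinf⟩ := exists_infinite_setOf_mul_one_add_mul_I_mem hopen ⟨w, hw⟩
  refine conditions_of_kippenhahnPoly_splitting hv hζ (p := c₁.re) (q := c₁.im) ?_
    (kippenhahnPoly_splitting hc hζ (hinf.mono fun s hs => ?_))
  · contrapose! hc
    exact Complex.ext hc.1 hc.2
  · exact exists_sq_eq_ellipseForm_of_kippenhahnPoly_mul_eq_zero hx hζ.le (hroot _ hs)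

end Splitting

section Factorization

theorem kippenhahnPoly_eq_mul {v b : ℝ} {b₁ b₂ : ℂ}
    (hnormSq : Complex.normSq b₁ = Complex.normSq b₂) (him : v ^ 2 * b ^ 2 = (b₁.im - b₂.im) ^ 2)
    (z : ℂ) (t Q : ℝ)
    (hQ : Q = (Complex.normSq b₁ + b ^ 2 / 4) * z.re ^ 2 + (b₁.im + b₂.im) * (z.re * z.im) +
      (1 + v ^ 2) * z.im ^ 2) :
    kippenhahnPoly v b₁ b₂ b z t =
      ((t - z.re * (b / 2)) ^ 2 - Q) * ((t + z.re * (b / 2)) ^ 2 - Q) := by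
  subst hQ
  have hD (β : ℂ) : Complex.normSq (z.re * β + z.im * Complex.I) =
      z.re ^ 2 * Complex.normSq β + 2 * β.im * (z.re * z.im) + z.im ^ 2 := by
    simp [Complex.normSq_apply]
    ring
  rw [kippenhahnPoly, hD, hD, ← hnormSq]
  linear_combination z.re ^ 2 * z.im ^ 2 * him

theorem isGreatest_setOf_sq_sub_mul_sq_sub_eq_zero {Q : ℝ} (hQ : 0 ≤ Q) (l : ℝ) :
    IsGreatest {t | ((t - l) ^ 2 - Q) * ((t + l) ^ 2 - Q) = 0} (max (l + √Q) (-l + √Q)) := by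
  constructor
  · rcases max_choice (l + √Q) (-l + √Q) with h | h <;> rw [h, mem_ofPred_eq]
    · rw [add_sub_cancel_left, Real.sq_sqrt hQ, sub_self, zero_mul]
    · rw [neg_add_cancel_comm, Real.sq_sqrt hQ, sub_self, mul_zero]
  · rintro t ht
    rw [le_max_iff]
    refine (mul_eq_zero.1 ht).imp (fun h => ?_) fun h => ?_
    · linarith [Real.le_sqrt_of_sq_le (sub_eq_zero.1 h).le]
    · linarith [Real.le_sqrt_of_sq_le (sub_eq_zero.1 h).le]

theorem norm_mk_lt_of_sq_lt_mul {a d e : ℝ} (ha : 0 < a) (h : e ^ 2 < a * d) :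
    ‖(⟨(a - d) / 2, e⟩ : ℂ)‖ < (a + d) / 2 := by
  have hd : 0 < d := pos_of_mul_pos_right ((sq_nonneg e).trans_lt h) ha.le
  rw [Complex.norm_def, Complex.normSq_mk, Real.sqrt_lt' (by positivity)]
  linarith

theorem isBiElliptical_numericalRange_triangularizedMatrix {v b : ℝ} {b₁ b₂ : ℂ} (hb : b ≠ 0)
    (hnormSq : Complex.normSq b₁ = Complex.normSq b₂)
    (him : v ^ 2 * b ^ 2 = (b₁.im - b₂.im) ^ 2) :
    IsBiElliptical (numericalRange (triangularizedMatrix (v * Complex.I) b₁ b₂ b)) := by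
  have hdet : ((b₁.im + b₂.im) / 2) ^ 2 < (Complex.normSq b₁ + b ^ 2 / 4) * (1 + v ^ 2) := by
    have h₁ := Complex.im_sq_le_normSq b₁
    have h₂ := Complex.im_sq_le_normSq b₂
    have hlt : ((b₁.im + b₂.im) / 2) ^ 2 < Complex.normSq b₁ + b ^ 2 / 4 := by
      linarith [sq_nonneg (b₁.im - b₂.im), sq_pos_of_ne_zero hb]
    exact hlt.trans_le (le_mul_of_one_le_right ((sq_nonneg _).trans hlt.le)
      (le_add_of_nonneg_right (sq_nonneg v)))
  have ha : 0 < Complex.normSq b₁ + b ^ 2 / 4 := by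
    linarith [Complex.normSq_nonneg b₁, sq_pos_of_ne_zero hb]
  have hζ := norm_mk_lt_of_sq_lt_mul ha hdet
  obtain ⟨E₁, h₁, hE₁⟩ := exists_isEllipse_isSupportFunction hζ (b / 2 : ℝ)
  obtain ⟨E₂, h₂, hE₂⟩ := exists_isEllipse_isSupportFunction hζ (-(b / 2) : ℝ)
  have hne : ((b / 2 : ℝ) : ℂ) ≠ (-(b / 2) : ℝ) := fun h => hb <| by
    linarith [Complex.ofReal_inj.1 h]
  refine ⟨E₁, E₂, _, _, h₁, h₂, hne, fun h => hne (hE₁.center_eq_of_subset_convexHull hE₂ h),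
    fun h => hne (hE₂.center_eq_of_subset_convexHull hE₁ h).symm, ?_⟩
  refine ((isSupportFunction_numericalRange_iff _).2 fun z => ?_).eq_of_convex_of_isClosed
    (hE₁.union hE₂).convexHull (convex_numericalRange _) (isCompact_numericalRange _).isClosed
    (convex_convexHull ℝ _)
    (isCompact_convexHull_of_isCompact (h₁.isCompact.union h₂.isCompact)).isClosed
  have hinner (x : ℝ) : ⟪z, (x : ℂ)⟫_ℝ = z.re * x := by simp [Complex.inner, mul_comm]
  rw [spectrum_realPart_star_smul_triangularizedMatrix, hinner, hinner, mul_neg]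
  convert isGreatest_setOf_sq_sub_mul_sq_sub_eq_zero (ellipseForm_nonneg hζ.le z) _ using 4
  refine kippenhahnPoly_eq_mul hnormSq him z _ _ ?_
  rw [ellipseForm_eq]
  ring

end Factorization

theorem theorem4p4_general (v : ℝ) (hv : v ≠ 0) (b₁ b₂ : ℂ) (b : ℝ) :
    IsBiElliptical (numericalRange (triangularizedMatrix (v * Complex.I) b₁ b₂ b)) ↔
      b ≠ 0 ∧ ‖b₁‖ = ‖b₂‖ ∧ v ^ 2 * b ^ 2 = (b₁.im - b₂.im) ^ 2 := by
  have hnorm : ‖b₁‖ = ‖b₂‖ ↔ Complex.normSq b₁ = Complex.normSq b₂ :=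
    Real.sqrt_inj (Complex.normSq_nonneg b₁) (Complex.normSq_nonneg b₂)
  rw [hnorm]
  constructor
  · rintro ⟨E₁, E₂, c₁, c₂, h₁, h₂, hne, h₁₂, h₂₁, hW⟩
    by_cases hc : c₁ = 0
    · exact conditions_of_numericalRange_eq_convexHull hv h₂ h₁ (hc ▸ hne.symm) h₂₁
        (union_comm E₁ E₂ ▸ hW)
    · exact conditions_of_numericalRange_eq_convexHull hv h₁ h₂ hc h₁₂ hW
  · rintro ⟨hb, hnormSq, him⟩
    exact isBiElliptical_numericalRange_triangularizedMatrix hb hnormSq him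

theorem theorem4p4 (v : ℝ) (hv : v ≠ 0) (b₁ b₂ : ℂ) (b : ℝ) (hb : 0 ≤ b) :
    IsBiElliptical (numericalRange (triangularizedMatrix (v * Complex.I) b₁ b₂ b)) ↔
      b ≠ 0 ∧ ‖b₁‖ = ‖b₂‖ ∧ v ^ 2 * b ^ 2 = (b₁.im - b₂.im) ^ 2 :=
  theorem4p4_general v hv b₁ b₂ b
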